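/- Let $D=\{(a_0,a_1,a_2)\in\mathbb R^3 \mid 0\le a_0,\ a_1^2+a_2^2\le a_0^2\}$ be the standard circular cone. Let $n\ge 1$, let $N_0,N_1,N_2\in\mathrm{Her}_n(\mathbb C)$ be Hermitian $n\times n$ matrices, and let $$\mathcal S_1(N_0,N_1,N_2)=\{a\in\mathbb R^3\mid a_0N_0+a_1N_1+a_2N_2\geqslant 0\}$$ be the spectrahedron they define, where $\geqslant 0$ means positive semidefinite. (i) We have $D\subseteq \mathcal S_1(N_0,N_1,N_2)$ if and only if there are $r\in\mathbb N$ and $P,Q\in\mathrm{Mat}_{r,n}(\mathbb C)$ with $$N_0=P^*P+Q^*Q,\qquad N_1=P^*Q+Q^*P,\qquad N_2=i(Q^*P-P^*Q).$$ (ii) If $D=\mathcal S_1(N_0,N_1,N_2)$, then there are matrices $P,Q$ as in (i) with $r=n-1$. Conversely, if there are matrices $P,Q$ as in (i) with $r=n-1$, and $N_0,N_1,N_2$ have no common nonzero kernel vector (this is the case for example if some real linear combination of $N_0,N_1,N_2$ is the identity matrix), then $D=\mathcal S_1(N_0,N_1,N_2)$. Moreover, if $D\subseteq\mathcal S_1(N_0,N_1,N_2)$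 and the topological boundary of $\mathcal S_1(N_0,N_1,N_2)$ in $\mathbb R^3$ contains at least $n+1$ distinct rays $\{tx\mid t\ge 0\}$, $x\ne 0$, that lie in $D$, then $D=\mathcal S_1(N_0,N_1,N_2)$, and there are matrices $P,Q$ as in (i) with $r=n-1$. -/

import Mathlib

open scoped Matrix ComplexOrder

/-- The standard circular cone in `ℝ³`. -/
def circularCone : Set (Fin 3 → ℝ) :=
  {a | 0 ≤ a 0 ∧ a 1 ^ 2 + a 2 ^ 2 ≤ a 0 ^ 2}

/-- The classical spectrahedron (first level of the free spectrahedron) of a tuple of complex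
matrices: all real `a` such that the linear combination `∑ aᵢ Nᵢ` is positive semidefinite. -/
def spectrahedron {d n : ℕ} (N : Fin d → Matrix (Fin n) (Fin n) ℂ) : Set (Fin d → ℝ) :=
  {a | (∑ i, a i • N i).PosSemidef}

/-- There are `r × n` matrices `P, Q` with `N₀ = P*P + Q*Q`, `N₁ = P*Q + Q*P` and
`N₂ = i(Q*P - P*Q)`. -/
def HasDecomposition {n : ℕ} (N : Fin 3 → Matrix (Fin n) (Fin n) ℂ) (r : ℕ) : Prop :=
  ∃ P Q : Matrix (Fin r) (Fin n) ℂ,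
    N 0 = Pᴴ * P + Qᴴ * Q ∧
    N 1 = Pᴴ * Q + Qᴴ * P ∧
    N 2 = Complex.I • (Qᴴ * P - Pᴴ * Q)

/-- A ray (emanating from the origin) in `ℝᵈ`. -/
def IsRay {d : ℕ} (R : Set (Fin d → ℝ)) : Prop :=
  ∃ x : Fin d → ℝ, x ≠ 0 ∧ R = {y | ∃ t : ℝ, 0 ≤ t ∧ y = t • x}

/-! With M = (N₁ - iN₂)/2, the pencil at the boundary point (1, Re w, -Im w), |w| = 1, is N₀ + w̄M +
wM*. So D ⊆ S₁ says that this trigonometric polynomial is positive semidefinite on the circle, and a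
decomposition is a factorization (P + wQ)*(P + wQ) of it. Part (i) is thus the matrix Fejér–Riesz
theorem in degree one (`exists_factorization_of_posSemidef`), obtained here from Schur complements
of block Toeplitz forms, averaging and compactness.

For (ii), P can be taken of full row rank (`exists_outer_factorization`), so at most n rows are
needed. If n - 1 rows do not suffice, P is square and invertible, det(P + wQ) is a nonzero
polynomial of degree at most n, and the pencil is positive definite on all but at most n boundary
rays of D. This rules out D = S₁ and, when N₀ > 0, bounds the number of common boundary rays by n.
With fewer than n rows, P + wQ always has a kernel, so the pencil is singular along the whole
boundary of D; if N₀ > 0, convexity then gives S₁ ⊆ D (`spectrahedron_subset_circularCone`). A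
common kernel is split off beforehand. -/

/-! ### The pencil on the boundary of the cone. -/

/-- Expansion of `(P + w Q)*(P + w Q)` for `w` on the unit circle. -/
theorem pencil_eq {m n : Type*} [Fintype m] [Fintype n] (P Q : Matrix m n ℂ) (w : ℂ)
    (hw : ‖w‖ = 1) :
    (P + w • Q)ᴴ * (P + w • Q) =
      Pᴴ * P + Qᴴ * Q + (starRingEnd ℂ w • (Qᴴ * P) + w • (Pᴴ * Q)) := by
  have h : w * starRingEnd ℂ w = 1 := by
    rw [Complex.mul_conj, Complex.normSq_eq_norm_sq, hw]; simp
  simp only [Matrix.conjTranspose_add, Matrix.conjTranspose_smul, Matrix.add_mul, Matrix.mul_add,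
    Matrix.smul_mul, Matrix.mul_smul, smul_add, smul_smul]
  have h' : w * star w = 1 := h
  rw [h', one_smul]
  simp only [starRingEnd_apply]
  abel

/-- The value of the pencil at the boundary point `t (1, Re w, -Im w)` of the circular cone. -/
theorem sum_smul_eq_of_decomposition {r n : ℕ} {N : Fin 3 → Matrix (Fin n) (Fin n) ℂ}
    {P Q : Matrix (Fin r) (Fin n) ℂ} (h0 : N 0 = Pᴴ * P + Qᴴ * Q) (h1 : N 1 = Pᴴ * Q + Qᴴ * P)
    (h2 : N 2 = Complex.I • (Qᴴ * P - Pᴴ * Q)) (a : Fin 3 → ℝ) (ρ : ℝ) (w : ℂ) (hw : ‖w‖ = 1)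
    (ha1 : a 1 = ρ * w.re) (ha2 : a 2 = -(ρ * w.im)) :
    ∑ i, a i • N i = (a 0 - ρ) • N 0 + ρ • ((P + w • Q)ᴴ * (P + w • Q)) := by
  rw [pencil_eq P Q w hw, Fin.sum_univ_three, h0, h1, h2, ha1, ha2]
  have e1 : starRingEnd ℂ w = w.re - Complex.I * w.im := by
    apply Complex.ext <;> simp
  have e2 : w • (Pᴴ * Q) = ((w.re : ℂ) + Complex.I * w.im) • (Pᴴ * Q) := by
    congr 1
    apply Complex.ext <;> simp
  rw [e1, e2]
  generalize w.re = x
  generalize w.im = y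
  simp only [← Complex.coe_smul]
  push_cast
  module

theorem exists_polar (x y : ℝ) :
    ∃ w : ℂ, ‖w‖ = 1 ∧ x = √(x ^ 2 + y ^ 2) * w.re ∧ y = -(√(x ^ 2 + y ^ 2) * w.im) := by
  by_cases h : (⟨x, -y⟩ : ℂ) = 0
  · have hx : x = 0 := by simpa using congrArg Complex.re h
    have hy : y = 0 := by simpa using congrArg Complex.im h
    exact ⟨1, by simp, by simp [hx, hy], by simp [hx, hy]⟩
  · have hn : ‖(⟨x, -y⟩ : ℂ)‖ = √(x ^ 2 + y ^ 2) := by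
      rw [Complex.norm_def, Complex.normSq_mk]; congr 1; ring
    have hn0 : ‖(⟨x, -y⟩ : ℂ)‖ ≠ 0 := norm_ne_zero_iff.mpr h
    refine ⟨(‖(⟨x, -y⟩ : ℂ)‖⁻¹ : ℝ) • ⟨x, -y⟩, ?_, ?_, ?_⟩
    · rw [norm_smul, norm_inv, norm_norm, inv_mul_cancel₀ hn0]
    · rw [← hn, Complex.smul_re]; simp only [smul_eq_mul]; field_simp
    · rw [← hn, Complex.smul_im]; simp only [smul_eq_mul]; field_simp

theorem mem_circularCone_iff {a : Fin 3 → ℝ} :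
    a ∈ circularCone ↔ √(a 1 ^ 2 + a 2 ^ 2) ≤ a 0 := by
  constructor
  · rintro ⟨h0, h⟩
    exact Real.sqrt_le_iff.mpr ⟨h0, h⟩
  · intro h
    exact Real.sqrt_le_iff.mp h

theorem HasDecomposition.posSemidef {n r : ℕ} {N : Fin 3 → Matrix (Fin n) (Fin n) ℂ}
    (h : HasDecomposition N r) : (N 0).PosSemidef := by
  obtain ⟨P, Q, h0, -, -⟩ := h
  rw [h0]
  exact (Matrix.posSemidef_conjTranspose_mul_self P).add
    (Matrix.posSemidef_conjTranspose_mul_self Q)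

theorem HasDecomposition.circularCone_subset {n r : ℕ} {N : Fin 3 → Matrix (Fin n) (Fin n) ℂ}
    (h : HasDecomposition N r) : circularCone ⊆ spectrahedron N := by
  intro a ha
  have hN := h.posSemidef
  obtain ⟨P, Q, h0, h1, h2⟩ := h
  obtain ⟨w, hw, hx, hy⟩ := exists_polar (a 1) (a 2)
  change (∑ i, a i • N i).PosSemidef
  rw [sum_smul_eq_of_decomposition h0 h1 h2 a _ w hw hx hy]
  exact (hN.smul (sub_nonneg.mpr (mem_circularCone_iff.mp ha))).add
    ((Matrix.posSemidef_conjTranspose_mul_self _).smul (Real.sqrt_nonneg _))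

/-- Padding with zero rows. -/
theorem HasDecomposition.mono {n r s : ℕ} {N : Fin 3 → Matrix (Fin n) (Fin n) ℂ}
    (h : HasDecomposition N r) (hrs : r ≤ s) : HasDecomposition N s := by
  obtain ⟨P, Q, h0, h1, h2⟩ := h
  obtain ⟨k, rfl⟩ := Nat.exists_eq_add_of_le hrs
  have key : ∀ A B : Matrix (Fin r) (Fin n) ℂ,
      ((Matrix.fromRows A (0 : Matrix (Fin k) (Fin n) ℂ)).submatrix finSumFinEquiv.symm id)ᴴ *
      ((Matrix.fromRows B (0 : Matrix (Fin k) (Fin n) ℂ)).submatrix finSumFinEquiv.symm id) =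
      Aᴴ * B := by
    intro A B
    rw [Matrix.conjTranspose_submatrix, Matrix.submatrix_mul_equiv]
    simp [Matrix.conjTranspose_fromRows_eq_fromCols_conjTranspose, Matrix.fromCols_mul_fromRows]
  refine ⟨(Matrix.fromRows P 0).submatrix finSumFinEquiv.symm id,
    (Matrix.fromRows Q 0).submatrix finSumFinEquiv.symm id, ?_, ?_, ?_⟩ <;>
  simp only [key] <;> assumption

/-! ### Isometries as matrices. -/

/-- An isometry onto a given subspace, as a matrix. -/
theorem exists_isometry_matrix {r : ℕ} (W : Submodule ℂ (EuclideanSpace ℂ (Fin r))) :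
    ∃ E : Matrix (Fin r) (Fin (Module.finrank ℂ W)) ℂ, Eᴴ * E = 1 ∧
      (∀ v : EuclideanSpace ℂ (Fin r), v ∈ W → (E * Eᴴ) *ᵥ v.ofLp = v.ofLp) ∧
      (∀ v : EuclideanSpace ℂ (Fin r), v ∈ Wᗮ → Eᴴ *ᵥ v.ofLp = 0) := by
  let b := stdOrthonormalBasis ℂ W
  let E : Matrix (Fin r) (Fin (Module.finrank ℂ W)) ℂ :=
    Matrix.of fun i j => (b j : EuclideanSpace ℂ (Fin r)) i
  have hE : ∀ (v : EuclideanSpace ℂ (Fin r)) j,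
      (Eᴴ *ᵥ v.ofLp) j = inner ℂ (b j : EuclideanSpace ℂ (Fin r)) v := by
    intro v j
    simp [Matrix.mulVec, dotProduct, E, PiLp.inner_apply, mul_comm]
  refine ⟨E, ?_, ?_, ?_⟩
  · ext i j
    have := hE (b j) i
    rw [← Submodule.coe_inner, orthonormal_iff_ite.mp b.orthonormal] at this
    rw [Matrix.one_apply, ← this]
    rfl
  · intro v hv
    rw [← Matrix.mulVec_mulVec]
    have h1 := b.sum_repr' ⟨v, hv⟩
    have h2 := congrArg (fun x : W => (x : EuclideanSpace ℂ (Fin r)).ofLp) h1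
    ext i
    have h3 := congrFun h2 i
    simp only [Submodule.coe_inner, Submodule.coe_sum, Submodule.coe_smul] at h3
    rw [← h3]
    simp only [Matrix.mulVec, dotProduct]
    rw [WithLp.ofLp_sum, Finset.sum_apply]
    refine Finset.sum_congr rfl fun j _ => ?_
    have := hE v j
    simp only [Matrix.mulVec, dotProduct] at this
    rw [this]
    simp [E, mul_comm]
  · intro v hv
    ext j
    rw [hE]
    exact hv _ (b j).2

/-! ### Positivity of block Toeplitz forms. -/

theorem IsPrimitiveRoot.sum_conj_pow_mul_pow {L : ℕ} {ζ : ℂ} (hζ : IsPrimitiveRoot ζ L)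
    {k l : ℕ} (hk : k < L) (hl : l < L) :
    ∑ j ∈ Finset.range L, star ((ζ ^ j) ^ k) * (ζ ^ j) ^ l = if k = l then (L : ℂ) else 0 := by
  have hL : L ≠ 0 := by omega
  have hn : ‖ζ‖ = 1 := hζ.norm'_eq_one hL
  have hc : star ζ * ζ = 1 := by
    have := Complex.conj_mul' ζ
    rw [hn] at this
    simpa using this
  have e : ∀ j, star ((ζ ^ j) ^ k) * (ζ ^ j) ^ l = (star ζ ^ k * ζ ^ l) ^ j := by
    intro j
    rw [star_pow, star_pow, mul_pow, ← pow_mul, ← pow_mul, ← pow_mul, ← pow_mul, mul_comm j k,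
      mul_comm j l]
  simp only [e]
  split_ifs with h
  · subst h
    rw [← mul_pow, hc]
    simp
  · have h1 : star ζ ^ k * ζ ^ l ≠ 1 := by
      intro h2
      apply h
      apply hζ.pow_inj hk hl
      calc ζ ^ k = ζ ^ k * (star ζ ^ k * ζ ^ l) := by rw [h2, mul_one]
        _ = (star ζ * ζ) ^ k * ζ ^ l := by rw [mul_pow]; ring
        _ = ζ ^ l := by rw [hc]; simp
    rw [geom_sum_eq h1]
    have h3 : (star ζ ^ k * ζ ^ l) ^ L = 1 := by
      rw [mul_pow, ← pow_mul, ← pow_mul, mul_comm k, mul_comm l, pow_mul, pow_mul, ← star_pow,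
        hζ.pow_eq_one]
      simp
    rw [h3]
    simp

/-- Parseval's identity over the roots of unity, for a sesquilinear form. -/
theorem IsPrimitiveRoot.sum_sesquilinear {n L : ℕ} {ζ : ℂ} (hζ : IsPrimitiveRoot ζ L)
    (B : Matrix (Fin n) (Fin n) ℂ) (a b : ℕ → Fin n → ℂ) :
    ∑ j ∈ Finset.range L, star (∑ k ∈ Finset.range L, (ζ ^ j) ^ k • a k) ⬝ᵥ
        B *ᵥ (∑ k ∈ Finset.range L, (ζ ^ j) ^ k • b k) =
      L * ∑ k ∈ Finset.range L, star (a k) ⬝ᵥ B *ᵥ b k := by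
  simp only [star_sum, star_smul, Matrix.mulVec_sum, Matrix.mulVec_smul, sum_dotProduct,
    dotProduct_sum, smul_dotProduct, dotProduct_smul, Finset.smul_sum]
  rw [Finset.sum_comm, Finset.mul_sum]
  refine Finset.sum_congr rfl fun l hl => ?_
  rw [Finset.sum_comm]
  have : ∀ k ∈ Finset.range L, ∑ j ∈ Finset.range L,
      (ζ ^ j) ^ l • star ((ζ ^ j) ^ k) • (star (a k) ⬝ᵥ B *ᵥ b l) =
      if k = l then L * (star (a k) ⬝ᵥ B *ᵥ b l) else 0 := by
    intro k hk
    rw [← ite_zero_mul,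
      ← hζ.sum_conj_pow_mul_pow (Finset.mem_range.mp hk) (Finset.mem_range.mp hl), Finset.sum_mul]
    exact Finset.sum_congr rfl fun j _ => by simp only [smul_eq_mul]; ring
  rw [Finset.sum_congr rfl this, Finset.sum_ite_eq', if_pos hl]

/-- The quadratic form of the block Toeplitz matrix with symbol `w̄ M + H + w M*`. -/
noncomputable def toeplitzForm {n : ℕ} (H M : Matrix (Fin n) (Fin n) ℂ) (m : ℕ)
    (y : ℕ → Fin n → ℂ) : ℂ :=
  ∑ k ∈ Finset.range (m + 1), star (y k) ⬝ᵥ H *ᵥ y k +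
    ∑ k ∈ Finset.range m, (star (y k) ⬝ᵥ M *ᵥ y (k + 1) + star (y (k + 1)) ⬝ᵥ Mᴴ *ᵥ y k)

/-- Up to the factor L, the form is the sum over the L-th roots of unity w of the symbol's quadratic
form at the vector ∑ wᵏ yₖ. -/
theorem toeplitzForm_nonneg {n : ℕ} {H M : Matrix (Fin n) (Fin n) ℂ}
    (hF : ∀ w : ℂ, ‖w‖ = 1 → (H + (starRingEnd ℂ w • M + w • Mᴴ)).PosSemidef) (m : ℕ)
    (y : ℕ → Fin n → ℂ) (hy : ∀ k, m < k → y k = 0) : 0 ≤ toeplitzForm H M m y := by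
  -- One slot more than the m + 1 coefficients, so that the shifted sequence `z`, which represents
  -- multiplication by w, does not wrap around.
  set L := m + 2 with hL
  have hζ := Complex.isPrimitiveRoot_exp L (by omega)
  set ζ := Complex.exp (2 * Real.pi * Complex.I / L)
  let z : ℕ → Fin n → ℂ := fun k => if k = 0 then 0 else y (k - 1)
  have hz : ∀ w : ℂ, ∑ k ∈ Finset.range L, w ^ k • z k =
      w • ∑ k ∈ Finset.range L, w ^ k • y k := by
    intro w
    rw [hL, Finset.sum_range_succ', Finset.sum_range_succ (n := m + 1) (f := fun k => w ^ k • y k),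
      hy (m + 1) (by omega)]
    simp [z, pow_succ', smul_smul, Finset.smul_sum]
  have key : (L : ℂ) * toeplitzForm H M m y = ∑ j ∈ Finset.range L,
      star (∑ k ∈ Finset.range L, (ζ ^ j) ^ k • y k) ⬝ᵥ
        (H + (starRingEnd ℂ (ζ ^ j) • M + (ζ ^ j) • Mᴴ)) *ᵥ
          (∑ k ∈ Finset.range L, (ζ ^ j) ^ k • y k) := by
    have e1 := hζ.sum_sesquilinear H y y
    have e2 := hζ.sum_sesquilinear M z y
    have e3 := hζ.sum_sesquilinear Mᴴ y z
    simp only [Matrix.add_mulVec, dotProduct_add, Matrix.smul_mulVec, dotProduct_smul,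
      Finset.sum_add_distrib]
    rw [e1]
    simp only [hz, star_smul, smul_dotProduct, Matrix.mulVec_smul, dotProduct_smul] at e2 e3
    simp only [starRingEnd_apply]
    rw [e2, e3, ← mul_add, ← mul_add]
    congr 1
    have f1 : ∑ k ∈ Finset.range L, star (y k) ⬝ᵥ H *ᵥ y k =
        ∑ k ∈ Finset.range (m + 1), star (y k) ⬝ᵥ H *ᵥ y k := by
      rw [hL, Finset.sum_range_succ, hy (m + 1) (by omega)]; simp
    have f2 : ∑ k ∈ Finset.range L, star (z k) ⬝ᵥ M *ᵥ y k =
        ∑ k ∈ Finset.range m, star (y k) ⬝ᵥ M *ᵥ y (k + 1) := by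
      rw [hL, Finset.sum_range_succ', Finset.sum_range_succ, hy (m + 1) (by omega)]; simp [z]
    have f3 : ∑ k ∈ Finset.range L, star (y k) ⬝ᵥ Mᴴ *ᵥ z k =
        ∑ k ∈ Finset.range m, star (y (k + 1)) ⬝ᵥ Mᴴ *ᵥ y k := by
      rw [hL, Finset.sum_range_succ', Finset.sum_range_succ, hy (m + 1) (by omega)]; simp [z]
    rw [f1, f2, f3, toeplitzForm, Finset.sum_add_distrib]
  have h1 : 0 ≤ (L : ℂ) * toeplitzForm H M m y := by
    rw [key]
    refine Finset.sum_nonneg fun j _ => (hF _ ?_).dotProduct_mulVec_nonneg _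
    rw [norm_pow, hζ.norm'_eq_one (by omega), one_pow]
  have h2 : (0 : ℂ) < L := by
    have : 0 < L := by omega
    exact_mod_cast this
  have h3 := mul_nonneg (inv_nonneg.mpr h2.le) h1
  rwa [← mul_assoc, inv_mul_cancel₀ h2.ne', one_mul] at h3

/-! ### Schur complements and their averages. -/

/-- Minimizing the Toeplitz form over all but the last variable leads to a recursion of Schur
complements. -/
noncomputable def schurSeq {n : ℕ} (H M : Matrix (Fin n) (Fin n) ℂ) :
    ℕ → Matrix (Fin n) (Fin n) ℂ
  | 0 => H
  | m + 1 => H - Mᴴ * (schurSeq H M m)⁻¹ * M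

theorem exists_toeplitzForm_eq {n : ℕ} {H M : Matrix (Fin n) (Fin n) ℂ} (m : ℕ)
    (hA : ∀ k < m, (schurSeq H M k).PosDef) (x : Fin n → ℂ) :
    ∃ y : ℕ → Fin n → ℂ, y m = x ∧ (∀ k, m < k → y k = 0) ∧
      toeplitzForm H M m y = star x ⬝ᵥ schurSeq H M m *ᵥ x := by
  induction m generalizing x with
  | zero =>
    refine ⟨fun k => if k = 0 then x else 0, by simp, fun k hk => by simp; omega, ?_⟩
    simp [toeplitzForm, schurSeq]
  | succ m ih =>
    have hm := hA m (by omega)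
    have hu := (Matrix.isUnit_iff_isUnit_det _).mp hm.isUnit
    set A := schurSeq H M m with hAdef
    -- The vector -A⁻¹Mx minimizes v*Av + v*Mx + x*M*v; completing the square leaves -x*M*A⁻¹Mx.
    obtain ⟨y, hy1, hy2, hy3⟩ := ih (fun k hk => hA k (by omega)) (-(A⁻¹ *ᵥ (M *ᵥ x)))
    refine ⟨Function.update y (m + 1) x, by simp, fun k hk => ?_, ?_⟩
    · rw [Function.update_of_ne (by omega)]
      exact hy2 k (by omega)
    · have e : toeplitzForm H M (m + 1) (Function.update y (m + 1) x) = toeplitzForm H M m y +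
          (star x ⬝ᵥ H *ᵥ x + (star (y m) ⬝ᵥ M *ᵥ x + star x ⬝ᵥ Mᴴ *ᵥ y m)) := by
        unfold toeplitzForm
        rw [Finset.sum_range_succ (n := m + 1), Finset.sum_range_succ (n := m)
          (f := fun k => star (Function.update y (m + 1) x k) ⬝ᵥ
            M *ᵥ Function.update y (m + 1) x (k + 1) +
            star (Function.update y (m + 1) x (k + 1)) ⬝ᵥ Mᴴ *ᵥ Function.update y (m + 1) x k)]
        have f1 : ∀ k ∈ Finset.range (m + 1), Function.update y (m + 1) x k = y k := by
          intro k hk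
          rw [Function.update_of_ne]
          have := Finset.mem_range.mp hk
          omega
        rw [Finset.sum_congr rfl fun k hk => by rw [f1 k hk],
          Finset.sum_congr (s₁ := Finset.range m) rfl fun k hk => by
            rw [f1 k (Finset.mem_range.mpr (by have := Finset.mem_range.mp hk; omega)),
              f1 (k + 1) (Finset.mem_range.mpr (by have := Finset.mem_range.mp hk; omega))],
          f1 m (by simp), Function.update_self]
        ring
      rw [e, hy3, hy1]
      have g1 : A *ᵥ (A⁻¹ *ᵥ (M *ᵥ x)) = M *ᵥ x := by
        rw [Matrix.mulVec_mulVec, Matrix.mul_nonsing_inv _ hu, Matrix.one_mulVec]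
      have g2 : schurSeq H M (m + 1) *ᵥ x = H *ᵥ x - Mᴴ *ᵥ (A⁻¹ *ᵥ (M *ᵥ x)) := by
        rw [schurSeq, Matrix.sub_mulVec, Matrix.mulVec_mulVec, Matrix.mulVec_mulVec,
          Matrix.mul_assoc]
      rw [g2]
      simp only [Matrix.mulVec_neg, dotProduct_neg, star_neg, neg_dotProduct, dotProduct_sub, g1]
      ring

/-- Once the earlier terms are positive definite, the quadratic form of the next one is a value of
the Toeplitz form. The shift by ε adds ε∑|yₖ|², which is positive because the last entry is x ≠ 0.
-/
theorem schurSeq_posDef {n : ℕ} {H M : Matrix (Fin n) (Fin n) ℂ} (hH : H.IsHermitian)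
    (hF : ∀ w : ℂ, ‖w‖ = 1 → (H + (starRingEnd ℂ w • M + w • Mᴴ)).PosSemidef) {ε : ℝ}
    (hε : 0 < ε) (m : ℕ) : (schurSeq (H + ε • 1) M m).PosDef := by
  have hH' : (H + ε • (1 : Matrix (Fin n) (Fin n) ℂ)).IsHermitian :=
    hH.add (Matrix.isHermitian_one.smul (IsSelfAdjoint.all ε))
  induction m using Nat.strong_induction_on with
  | _ m ih =>
    refine .of_dotProduct_mulVec_pos ?_ fun x hx => ?_
    · cases m with
      | zero => exact hH'
      | succ m =>
        exact hH'.sub (Matrix.isHermitian_conjTranspose_mul_mul M (ih m (by omega)).inv.isHermitian)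
    · obtain ⟨y, hy1, hy2, hy3⟩ := exists_toeplitzForm_eq m ih x
      have e : toeplitzForm (H + ε • 1) M m y = toeplitzForm H M m y +
          ∑ k ∈ Finset.range (m + 1), ε • (star (y k) ⬝ᵥ y k) := by
        unfold toeplitzForm
        simp only [Matrix.add_mulVec, dotProduct_add, Matrix.smul_mulVec, Matrix.one_mulVec,
          dotProduct_smul, Finset.sum_add_distrib]
        ring
      rw [← hy3, e]
      refine add_pos_of_nonneg_of_pos (toeplitzForm_nonneg hF m y hy2) ?_
      refine Finset.sum_pos' (fun k _ => smul_nonneg hε.le (dotProduct_star_self_nonneg _))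
        ⟨m, by simp, ?_⟩
      rw [hy1]
      exact smul_pos hε (Matrix.dotProduct_star_self_pos_iff.mpr hx)

/-- Each block matrix with rows (Aₘ, M) and (M*, H - Aₘ₊₁) has Schur complement zero. Summing over m
< K telescopes, since A₀ = H, and adding A_K ≥ 0 makes the diagonal blocks add up to (K + 1)H.
Averaging makes convergence of the Schur sequence unnecessary. -/
theorem fromBlocks_sum_schurSeq_posSemidef {n : ℕ} {H M : Matrix (Fin n) (Fin n) ℂ}
    (hA : ∀ m, (schurSeq H M m).PosDef) (K : ℕ) :
    (Matrix.fromBlocks (∑ m ∈ Finset.range K, schurSeq H M m) ((K : ℝ) • M) ((K : ℝ) • Mᴴ)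
      (((K : ℝ) + 1) • H - ∑ m ∈ Finset.range K, schurSeq H M m)).PosSemidef := by
  have h1 : ∀ m, (Matrix.fromBlocks (schurSeq H M m) M Mᴴ
      (H - schurSeq H M (m + 1))).PosSemidef := by
    intro m
    have := (hA m).isUnit.invertible
    rw [Matrix.PosDef.fromBlocks₁₁ _ _ (hA m)]
    simp [schurSeq, Matrix.PosSemidef.zero]
  have h2 : ∀ K, (Matrix.fromBlocks (∑ m ∈ Finset.range K, schurSeq H M m) ((K : ℝ) • M)
      ((K : ℝ) • Mᴴ) (((K : ℝ) + 1) • H - ∑ m ∈ Finset.range K, schurSeq H M m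
        - schurSeq H M K)).PosSemidef := by
    intro K
    induction K with
    | zero => simpa [schurSeq] using Matrix.PosSemidef.zero
    | succ K ih =>
      convert ih.add (h1 K) using 1
      rw [Matrix.fromBlocks_add, Finset.sum_range_succ]
      congr 1 <;> push_cast <;> module
  have h3 : (Matrix.fromBlocks (0 : Matrix (Fin n) (Fin n) ℂ) 0 0 (schurSeq H M K)).PosSemidef := by
    have := (hA K).posSemidef.conjTranspose_mul_mul_same
      (Matrix.fromCols (0 : Matrix (Fin n) (Fin n) ℂ) (1 : Matrix (Fin n) (Fin n) ℂ))
    simp only [Matrix.conjTranspose_fromCols_eq_fromRows_conjTranspose, Matrix.fromRows_mul,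
      Matrix.mul_fromCols] at this
    convert this using 1
    ext (i | i) (j | j) <;> simp
  convert (h2 K).add h3 using 1
  rw [Matrix.fromBlocks_add]
  simp

/-! ### Compactness and the Fejér–Riesz theorem. -/

theorem isCompact_setOf_norm_entry_le {m n : Type*} (C : ℝ) :
    IsCompact {A : Matrix m n ℂ | ∀ i j, ‖A i j‖ ≤ C} := by
  have : {A : Matrix m n ℂ | ∀ i j, ‖A i j‖ ≤ C} =
      Set.pi Set.univ fun _ => Set.pi Set.univ fun _ => Metric.closedBall (0 : ℂ) C := by
    ext A
    exact ⟨fun h i _ j _ => mem_closedBall_zero_iff.mpr (h i j),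
      fun h i j => mem_closedBall_zero_iff.mp (h i trivial j trivial)⟩
  rw [this]
  exact isCompact_univ_pi fun _ => isCompact_univ_pi fun _ => isCompact_closedBall _ _

theorem norm_entry_sq_le {m n : Type*} [Fintype m] [Fintype n] (A : Matrix m n ℂ) (i : m) (j : n) :
    ‖A i j‖ ^ 2 ≤ ((Aᴴ * A) j j).re := by
  have : ((Aᴴ * A) j j).re = ∑ k, ‖A k j‖ ^ 2 := by
    rw [Matrix.mul_apply, Complex.re_sum]
    refine Finset.sum_congr rfl fun k _ => ?_
    rw [Matrix.conjTranspose_apply, ← starRingEnd_apply, Complex.conj_mul']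
    norm_cast
  rw [this]
  exact Finset.single_le_sum (f := fun k => ‖A k j‖ ^ 2) (fun k _ => by positivity)
    (Finset.mem_univ i)

/-- The pairs `(P, Q)` with `P*P + Q*Q` of bounded trace are bounded. -/
theorem norm_entry_le_of_trace {m n : Type*} [Fintype m] [Fintype n] {P Q : Matrix m n ℂ} {C : ℝ}
    (hC : (Pᴴ * P + Qᴴ * Q).trace.re ≤ C) (i : m) (j : n) :
    ‖P i j‖ ≤ C + 1 ∧ ‖Q i j‖ ≤ C + 1 := by
  have h : ∀ A : Matrix m n ℂ, ‖A i j‖ ^ 2 ≤ (Aᴴ * A).trace.re := by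
    intro A
    rw [Matrix.trace, Complex.re_sum]
    exact (norm_entry_sq_le A i j).trans (Finset.single_le_sum
      (f := fun j => ((Aᴴ * A) j j).re)
      (fun k _ => (sq_nonneg ‖A i k‖).trans (norm_entry_sq_le A i k)) (Finset.mem_univ j))
  have hP := h P
  have hQ := h Q
  rw [Matrix.trace_add, Complex.add_re] at hC
  have := sq_nonneg ‖P i j‖
  have := sq_nonneg ‖Q i j‖
  constructor <;> nlinarith [sq_nonneg (‖P i j‖ - 1), sq_nonneg (‖Q i j‖ - 1)]

open scoped MatrixOrder Matrix.Norms.L2Operator in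
theorem Matrix.PosSemidef.exists_eq_conjTranspose_mul_self {m : Type*} [Fintype m] [DecidableEq m]
    {A : Matrix m m ℂ} (hA : A.PosSemidef) : ∃ B : Matrix m m ℂ, A = Bᴴ * B :=
  CStarAlgebra.nonneg_iff_eq_star_mul_self.mp hA.nonneg

/-- The block columns of a square root of the averaged block matrix serve as Q and P. Taking ε = 1/K
lets one limit remove both the shift and the factor 1 + 1/K. -/
theorem exists_approx_factorization {n : ℕ} {H M : Matrix (Fin n) (Fin n) ℂ} (hH : H.IsHermitian)
    (hF : ∀ w : ℂ, ‖w‖ = 1 → (H + (starRingEnd ℂ w • M + w • Mᴴ)).PosSemidef) {K : ℕ}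
    (hK : 0 < K) : ∃ P Q : Matrix (Fin n ⊕ Fin n) (Fin n) ℂ,
      Pᴴ * P + Qᴴ * Q = (1 + (K : ℝ)⁻¹) • (H + (K : ℝ)⁻¹ • 1) ∧ Qᴴ * P = M := by
  have hK' : (0 : ℝ) < K := by exact_mod_cast hK
  set H' := H + (K : ℝ)⁻¹ • (1 : Matrix (Fin n) (Fin n) ℂ) with hH'
  have h := (fromBlocks_sum_schurSeq_posSemidef
    (fun m => schurSeq_posDef hH hF (inv_pos.mpr hK') m) K).smul (inv_pos.mpr hK').le
  obtain ⟨V, hV⟩ := h.exists_eq_conjTranspose_mul_self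
  rw [← Matrix.fromCols_toCols V, Matrix.conjTranspose_fromCols_eq_fromRows_conjTranspose,
    Matrix.fromRows_mul_fromCols, Matrix.fromBlocks_smul, Matrix.fromBlocks_inj] at hV
  obtain ⟨e1, e2, -, e4⟩ := hV
  refine ⟨V.toCols₂, V.toCols₁, ?_, ?_⟩
  · rw [← e1, ← e4, ← smul_add, sub_add_cancel, smul_smul]
    congr 1
    field_simp
  · rw [← e2, smul_smul, inv_mul_cancel₀ hK'.ne', one_smul]

/-- The Fejér–Riesz theorem for matrix trigonometric polynomials of degree one. -/
theorem exists_factorization_of_posSemidef {n : ℕ} {H M : Matrix (Fin n) (Fin n) ℂ}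
    (hH : H.IsHermitian)
    (hF : ∀ w : ℂ, ‖w‖ = 1 → (H + (starRingEnd ℂ w • M + w • Mᴴ)).PosSemidef) :
    ∃ P Q : Matrix (Fin n ⊕ Fin n) (Fin n) ℂ, Pᴴ * P + Qᴴ * Q = H ∧ Qᴴ * P = M := by
  let f : Matrix (Fin n ⊕ Fin n) (Fin n) ℂ × Matrix (Fin n ⊕ Fin n) (Fin n) ℂ →
      Matrix (Fin n) (Fin n) ℂ × Matrix (Fin n) (Fin n) ℂ :=
    fun p => (p.1ᴴ * p.1 + p.2ᴴ * p.2, p.2ᴴ * p.1)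
  have hf : Continuous f := by fun_prop
  let g : ℝ → Matrix (Fin n) (Fin n) ℂ := fun t => (1 + t) • (H + t • 1)
  have hg : Continuous g := by fun_prop
  have hg0 : g 0 = H := by simp [g]
  have hlim : Filter.Tendsto (fun K : ℕ => g ((K : ℝ)⁻¹)) Filter.atTop (nhds H) := by
    have := (hg.tendsto 0).comp tendsto_inv_atTop_nhds_zero_nat
    rwa [hg0] at this
  have htr : Continuous fun A : Matrix (Fin n) (Fin n) ℂ => A.trace.re := by fun_prop
  set C := H.trace.re + 1
  have hC : ∀ᶠ K : ℕ in Filter.atTop, (g ((K : ℝ)⁻¹)).trace.re ≤ C :=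
    (((htr.tendsto H).comp hlim).eventually (gt_mem_nhds (lt_add_one _))).mono fun _ h => h.le
  have hK := ((isCompact_setOf_norm_entry_le (m := Fin n ⊕ Fin n) (n := Fin n) (C + 1)).prod
    (isCompact_setOf_norm_entry_le (m := Fin n ⊕ Fin n) (n := Fin n) (C + 1))).image hf
  -- The approximate factors are eventually bounded by the trace, and the image of a compact set is
  -- closed, so the limit is attained.
  have hmem : (H, M) ∈ f '' ({A | ∀ i j, ‖A i j‖ ≤ C + 1} ×ˢ {A | ∀ i j, ‖A i j‖ ≤ C + 1}) := by
    refine hK.isClosed.mem_of_tendsto (hlim.prodMk_nhds tendsto_const_nhds) ?_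
    filter_upwards [hC, Filter.eventually_gt_atTop 0] with K hKC hK0
    obtain ⟨P, Q, h1, h2⟩ := exists_approx_factorization hH hF hK0
    refine ⟨(P, Q), ?_, Prod.ext h1 h2⟩
    have hb := norm_entry_le_of_trace (P := P) (Q := Q) (C := C) (by rw [h1]; exact hKC)
    exact ⟨fun i j => (hb i j).1, fun i j => (hb i j).2⟩
  obtain ⟨⟨P, Q⟩, -, h⟩ := hmem
  exact ⟨P, Q, congrArg Prod.fst h, congrArg Prod.snd h⟩

theorem exists_hasDecomposition {n : ℕ} {N : Fin 3 → Matrix (Fin n) (Fin n) ℂ}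
    (hN : ∀ i, (N i).IsHermitian) (h : circularCone ⊆ spectrahedron N) :
    ∃ r, HasDecomposition N r := by
  -- Solving N₁ = M + M*, N₂ = i(M - M*) for M, which is to become Q*P.
  let M : Matrix (Fin n) (Fin n) ℂ := (2⁻¹ : ℂ) • (N 1 - Complex.I • N 2)
  have hM : Mᴴ = (2⁻¹ : ℂ) • (N 1 + Complex.I • N 2) := by
    simp [M, Matrix.conjTranspose_smul, Matrix.conjTranspose_sub, (hN 1).eq, (hN 2).eq]
  have hI : Complex.I * Complex.I = -1 := Complex.I_mul_I
  have e1 : N 1 = M + Mᴴ := by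
    rw [hM]; module
  have e2 : N 2 = Complex.I • (M - Mᴴ) := by
    have : Complex.I • (M - Mᴴ) = (-(Complex.I * Complex.I)) • N 2 := by
      rw [hM]; module
    rw [this, hI, neg_neg, one_smul]
  have hF : ∀ w : ℂ, ‖w‖ = 1 → (N 0 + (starRingEnd ℂ w • M + w • Mᴴ)).PosSemidef := by
    intro w hw
    have hmem : ![1, w.re, -w.im] ∈ spectrahedron N := by
      apply h
      refine ⟨by simp, ?_⟩
      have := Complex.normSq_eq_norm_sq w
      rw [hw, Complex.normSq_apply] at this
      simp
      nlinarith
    have hmem' : (∑ i, ![1, w.re, -w.im] i • N i).PosSemidef := hmem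
    convert hmem' using 1
    rw [Fin.sum_univ_three, e1, e2]
    have c1 : starRingEnd ℂ w • M = ((w.re : ℂ) - Complex.I * w.im) • M := by
      congr 1
      apply Complex.ext <;> simp
    have c2 : w • Mᴴ = ((w.re : ℂ) + Complex.I * w.im) • Mᴴ := by
      congr 1
      apply Complex.ext <;> simp
    rw [c1, c2]
    simp only [← Complex.coe_smul, Matrix.cons_val]
    push_cast
    module
  obtain ⟨P, Q, h1, h2⟩ := exists_factorization_of_posSemidef (hN 0) hF
  have h3 : Pᴴ * Q = Mᴴ := by rw [← h2, Matrix.conjTranspose_mul, Matrix.conjTranspose_conjTranspose]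
  have key : ∀ A B : Matrix (Fin n ⊕ Fin n) (Fin n) ℂ,
      (A.submatrix finSumFinEquiv.symm id)ᴴ * (B.submatrix finSumFinEquiv.symm id) = Aᴴ * B := by
    intro A B
    rw [Matrix.conjTranspose_submatrix, Matrix.submatrix_mul_equiv, Matrix.submatrix_id_id]
  refine ⟨n + n, P.submatrix finSumFinEquiv.symm id, Q.submatrix finSumFinEquiv.symm id, ?_, ?_, ?_⟩
  · rw [key, key, h1]
  · rw [key, key, h2, h3, e1, add_comm]
  · rw [key, key, h2, h3, e2]

/-! ### Outer factorizations. -/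

/-- Orthonormal basis of the column space of a matrix, as the columns of a matrix. -/
theorem exists_isometry_columnSpace {r : ℕ} {κ : Type*} [Fintype κ] (A : Matrix (Fin r) κ ℂ) :
    ∃ (s : ℕ) (E : Matrix (Fin r) (Fin s) ℂ), Eᴴ * E = 1 ∧ E * Eᴴ * A = A ∧
      ∀ v, Aᴴ *ᵥ v = 0 → Eᴴ *ᵥ v = 0 := by
  let W : Submodule ℂ (EuclideanSpace ℂ (Fin r)) :=
    Submodule.span ℂ (Set.range fun j => WithLp.toLp 2 fun i => A i j)
  obtain ⟨E, h1, h2, h3⟩ := exists_isometry_matrix W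
  refine ⟨_, E, h1, ?_, fun v hv => h3 (WithLp.toLp 2 v) ?_⟩
  · ext i j
    exact congrFun (h2 (WithLp.toLp 2 fun i => A i j) (Submodule.subset_span ⟨j, rfl⟩)) i
  · rw [Submodule.mem_orthogonal]
    intro u hu
    induction hu using Submodule.span_induction with
    | mem x hx =>
      obtain ⟨j, rfl⟩ := hx
      have := congrFun hv j
      simpa [Matrix.mulVec, dotProduct, PiLp.inner_apply, mul_comm] using this
    | zero => simp
    | add x y _ _ hx hy => rw [inner_add_left, hx, hy, add_zero]
    | smul c x _ hx => rw [inner_smul_left, hx, mul_zero]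

/-- Among all factorizations with a fixed number of rows, there is one with `P*P` of largest
trace. -/
theorem exists_max_trace {r n : ℕ} (P₀ Q₀ : Matrix (Fin r) (Fin n) ℂ) :
    ∃ P Q : Matrix (Fin r) (Fin n) ℂ,
      Pᴴ * P + Qᴴ * Q = P₀ᴴ * P₀ + Q₀ᴴ * Q₀ ∧ Qᴴ * P = Q₀ᴴ * P₀ ∧
      ∀ P' Q' : Matrix (Fin r) (Fin n) ℂ,
        P'ᴴ * P' + Q'ᴴ * Q' = P₀ᴴ * P₀ + Q₀ᴴ * Q₀ → Q'ᴴ * P' = Q₀ᴴ * P₀ →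
        (P'ᴴ * P').trace.re ≤ (Pᴴ * P).trace.re := by
  let f : Matrix (Fin r) (Fin n) ℂ × Matrix (Fin r) (Fin n) ℂ →
      Matrix (Fin n) (Fin n) ℂ × Matrix (Fin n) (Fin n) ℂ :=
    fun p => (p.1ᴴ * p.1 + p.2ᴴ * p.2, p.2ᴴ * p.1)
  have hf : Continuous f := by fun_prop
  let g : Matrix (Fin r) (Fin n) ℂ × Matrix (Fin r) (Fin n) ℂ → ℝ :=
    fun p => (p.1ᴴ * p.1).trace.re
  have hg : Continuous g := by fun_prop
  set C := (P₀ᴴ * P₀ + Q₀ᴴ * Q₀).trace.re with hC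
  have hcl : IsClosed ({p | f p = f (P₀, Q₀)}) := isClosed_eq hf continuous_const
  have hK : IsCompact ({p | f p = f (P₀, Q₀)}) := by
    refine ((isCompact_setOf_norm_entry_le (m := Fin r) (n := Fin n) (C + 1)).prod
      (isCompact_setOf_norm_entry_le (C + 1))).of_isClosed_subset hcl ?_
    rintro ⟨P, Q⟩ h
    have h1 : Pᴴ * P + Qᴴ * Q = P₀ᴴ * P₀ + Q₀ᴴ * Q₀ := congrArg Prod.fst h
    have hb := norm_entry_le_of_trace (P := P) (Q := Q) (C := C) (by rw [h1])
    exact ⟨fun i j => (hb i j).1, fun i j => (hb i j).2⟩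
  have hne : {p | f p = f (P₀, Q₀)}.Nonempty := ⟨(P₀, Q₀), Eq.refl (f (P₀, Q₀))⟩
  obtain ⟨⟨P, Q⟩, hmem, hmax⟩ := hK.exists_isMaxOn hne hg.continuousOn
  have hmem' : f (P, Q) = f (P₀, Q₀) := hmem
  refine ⟨P, Q, congrArg Prod.fst hmem', congrArg Prod.snd hmem', fun P' Q' h1 h2 => ?_⟩
  have h3 : f (P', Q') = f (P₀, Q₀) := Prod.ext h1 h2
  have h4 : g (P', Q') ≤ g (P, Q) := isMaxOn_iff.mp hmax (P', Q') h3
  exact h4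

/-- Outer factorizations: the matrix `P` can be chosen of full row rank. -/
theorem exists_outer_factorization {r n : ℕ} (P₀ Q₀ : Matrix (Fin r) (Fin n) ℂ) :
    ∃ (s : ℕ) (P Q : Matrix (Fin s) (Fin n) ℂ),
      Pᴴ * P + Qᴴ * Q = P₀ᴴ * P₀ + Q₀ᴴ * Q₀ ∧ Qᴴ * P = Q₀ᴴ * P₀ ∧
      ∀ u, Pᴴ *ᵥ u = 0 → u = 0 := by
  obtain ⟨P, Q, h1, h2, hmax⟩ := exists_max_trace P₀ Q₀
  obtain ⟨s, E, hE, hEP, hE0⟩ := exists_isometry_columnSpace P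
  -- Maximality forces the columns of Q into the column space of P: moving the orthogonal component
  -- D of Q over to P gives the factorization (P + D, RQ), with the trace of P*P raised by that of
  -- D*D.
  have hQ : E * Eᴴ * Q = Q := by
    set R := E * Eᴴ with hR
    have hRh : Rᴴ = R := by simp [hR]
    have hRR : R * R = R := by
      rw [hR, Matrix.mul_assoc, ← Matrix.mul_assoc Eᴴ, hE, Matrix.one_mul]
    have hPR : Pᴴ * R = Pᴴ := by
      rw [← hRh, ← Matrix.conjTranspose_mul, hEP]
    let D := Q - R * Q
    have hRD : R * D = 0 := by
      simp only [D, Matrix.mul_sub, ← Matrix.mul_assoc, hRR, sub_self]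
    have hPD : Pᴴ * D = 0 := by
      rw [← hPR, Matrix.mul_assoc, hRD, Matrix.mul_zero]
    have hDP : Dᴴ * P = 0 := by
      rw [← Matrix.conjTranspose_conjTranspose P, ← Matrix.conjTranspose_mul, hPD,
        Matrix.conjTranspose_zero]
    have hQQ : Qᴴ * Q = Dᴴ * D + (R * Q)ᴴ * (R * Q) := by
      have e : Q = D + R * Q := by simp [D]
      have f1 : Dᴴ * (R * Q) = 0 := by
        rw [← Matrix.mul_assoc, ← hRh, ← Matrix.conjTranspose_mul, hRD]; simp
      have f2 : (R * Q)ᴴ * D = 0 := by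
        rw [Matrix.conjTranspose_mul, hRh, Matrix.mul_assoc, hRD, Matrix.mul_zero]
      nth_rw 1 2 [e]
      rw [Matrix.conjTranspose_add, Matrix.add_mul, Matrix.mul_add, Matrix.mul_add, f1, f2]
      simp
    have hPP : (P + D)ᴴ * (P + D) = Pᴴ * P + Dᴴ * D := by
      rw [Matrix.conjTranspose_add, Matrix.add_mul, Matrix.mul_add, Matrix.mul_add, hPD, hDP]
      simp
    have := hmax (P + D) (R * Q) (by rw [hPP, ← h1, hQQ, add_assoc]) (by
      rw [← h2, Matrix.conjTranspose_mul, hRh, Matrix.mul_assoc, Matrix.mul_add, hRD, hEP,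
        add_zero])
    rw [hPP, Matrix.trace_add, Complex.add_re] at this
    have h0 := (Matrix.posSemidef_conjTranspose_mul_self D).trace_nonneg
    have h3 : (Dᴴ * D).trace = 0 := by
      obtain ⟨g1, g2⟩ := Complex.le_def.mp h0
      apply Complex.ext
      · simp only [Complex.zero_re] at g1 ⊢; linarith
      · exact g2.symm
    exact (sub_eq_zero.mp (Matrix.trace_conjTranspose_mul_self_eq_zero_iff.mp h3)).symm
  have key : ∀ A B : Matrix (Fin r) (Fin n) ℂ, E * Eᴴ * B = B →
      (Eᴴ * A)ᴴ * (Eᴴ * B) = Aᴴ * B := by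
    intro A B hB
    rw [Matrix.conjTranspose_mul, Matrix.conjTranspose_conjTranspose, Matrix.mul_assoc,
      ← Matrix.mul_assoc E, hB]
  refine ⟨s, Eᴴ * P, Eᴴ * Q, ?_, ?_, ?_⟩
  · rw [key P P hEP, key Q Q hQ, h1]
  · rw [key Q P hEP, h2]
  · intro u hu
    have h3 : Pᴴ *ᵥ (E *ᵥ u) = 0 := by
      rwa [Matrix.conjTranspose_mul, Matrix.conjTranspose_conjTranspose,
        ← Matrix.mulVec_mulVec] at hu
    have h4 := hE0 _ h3
    rwa [Matrix.mulVec_mulVec, hE, Matrix.one_mulVec] at h4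

/-! ### Interior points and the determinant of P + wQ. -/

theorem isHermitian_sum_smul {d n : ℕ} {N : Fin d → Matrix (Fin n) (Fin n) ℂ}
    (hN : ∀ i, (N i).IsHermitian) (a : Fin d → ℝ) : (∑ i, a i • N i).IsHermitian := by
  unfold Matrix.IsHermitian
  rw [Matrix.conjTranspose_sum]
  exact Finset.sum_congr rfl fun i _ => (hN i).smul (IsSelfAdjoint.all (a i))

/-- Points where the pencil is positive definite are interior. -/
theorem mem_interior_spectrahedron {d n : ℕ} {N : Fin d → Matrix (Fin n) (Fin n) ℂ}
    (hN : ∀ i, (N i).IsHermitian) {a : Fin d → ℝ} (ha : (∑ i, a i • N i).PosDef) :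
    a ∈ interior (spectrahedron N) := by
  have hcont : Continuous fun p : (Fin d → ℝ) × EuclideanSpace ℂ (Fin n) =>
      (star p.2.ofLp ⬝ᵥ (∑ i, p.1 i • N i) *ᵥ p.2.ofLp).re := by fun_prop
  have key : ∀ᶠ b in nhds a, ∀ v ∈ Metric.sphere (0 : EuclideanSpace ℂ (Fin n)) 1,
      0 < (star v.ofLp ⬝ᵥ (∑ i, b i • N i) *ᵥ v.ofLp).re := by
    -- Compactness of the unit sphere gives one neighbourhood of a that works for all vectors.
    refine (isCompact_sphere _ _).eventually_forall_of_forall_eventually fun v hv => ?_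
    refine hcont.continuousAt.eventually (lt_mem_nhds ?_)
    have hv0 : v.ofLp ≠ 0 := by
      rintro h
      have : v = 0 := by ext i; exact congrFun h i
      simp [this] at hv
    exact (Complex.lt_def.mp (ha.dotProduct_mulVec_pos hv0)).1
  rw [mem_interior_iff_mem_nhds]
  filter_upwards [key] with b hb
  have hh := isHermitian_sum_smul hN b
  refine .of_dotProduct_mulVec_nonneg hh fun x => ?_
  by_cases hx : x = 0
  · simp [hx]
  have him : (star x ⬝ᵥ (∑ i, b i • N i) *ᵥ x).im = 0 := hh.im_star_dotProduct_mulVec_self x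
  have hx' : WithLp.toLp 2 x ≠ (0 : EuclideanSpace ℂ (Fin n)) := by
    intro h; exact hx (congrArg WithLp.ofLp h)
  have hn : ‖(WithLp.toLp 2 x : EuclideanSpace ℂ (Fin n))‖ ≠ 0 := norm_ne_zero_iff.mpr hx'
  have h1 := hb ((‖(WithLp.toLp 2 x : EuclideanSpace ℂ (Fin n))‖⁻¹ : ℝ) • WithLp.toLp 2 x) (by
    rw [mem_sphere_zero_iff_norm, norm_smul, norm_inv, norm_norm, inv_mul_cancel₀ hn])
  simp only [WithLp.ofLp_smul, star_smul, Matrix.mulVec_smul, smul_dotProduct, dotProduct_smul,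
    star_trivial, Complex.smul_re, smul_eq_mul, ← mul_assoc] at h1
  have h2 : 0 ≤ (star x ⬝ᵥ (∑ i, b i • N i) *ᵥ x).re :=
    (pos_of_mul_pos_right h1 (mul_self_nonneg _)).le
  exact Complex.le_def.mpr ⟨h2, him.symm⟩

theorem infinite_unit_circle : {w : ℂ | ‖w‖ = 1}.Infinite := by
  have h : {w : ℂ | ‖w‖ = 1} = Metric.sphere (0 : ℂ) 1 := by ext; simp
  rw [h]
  refine (isPreconnected_sphere (by rw [Complex.rank_real_complex]; norm_num) 0 1).infinite_of_nontrivial ?_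
  exact ⟨1, by simp, -1, by simp, by norm_num⟩

/-- The determinant of the matrix pencil `P + w Q` as a polynomial in `w`. -/
theorem exists_polynomial_det {n : ℕ} (P Q : Matrix (Fin n) (Fin n) ℂ) (hP : P.det ≠ 0) :
    ∃ p : Polynomial ℂ, p ≠ 0 ∧ p.natDegree ≤ n ∧ ∀ w, p.eval w = (P + w • Q).det := by
  let p := ((Polynomial.X : Polynomial ℂ) • Q.map Polynomial.C + P.map Polynomial.C).det
  have hev : ∀ w, p.eval w = (P + w • Q).det := by
    intro w
    rw [← Polynomial.coe_evalRingHom, RingHom.map_det]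
    congr 1
    ext i j
    simp
    ring
  refine ⟨p, ?_, ?_, hev⟩
  · rintro h
    have := hev 0
    rw [h] at this
    simp at this
    exact hP this.symm
  · simpa using Polynomial.natDegree_det_X_add_C_le Q P

/-- Full row rank gives s ≤ n rows, and s < n could be padded to n - 1; hence s = n and P is
invertible. -/
theorem HasDecomposition.exists_outer {n r : ℕ} {N : Fin 3 → Matrix (Fin n) (Fin n) ℂ}
    (h : HasDecomposition N r) (hn : ¬ HasDecomposition N (n - 1)) :
    ∃ P Q : Matrix (Fin n) (Fin n) ℂ, N 0 = Pᴴ * P + Qᴴ * Q ∧ N 1 = Pᴴ * Q + Qᴴ * P ∧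
      N 2 = Complex.I • (Qᴴ * P - Pᴴ * Q) ∧ P.det ≠ 0 := by
  obtain ⟨P₀, Q₀, h0, h1, h2⟩ := h
  obtain ⟨s, P, Q, e0, e1, hinj⟩ := exists_outer_factorization P₀ Q₀
  have e2 : Pᴴ * Q = P₀ᴴ * Q₀ := by
    have := congrArg Matrix.conjTranspose e1
    simpa [Matrix.conjTranspose_mul] using this
  rw [← e0] at h0
  rw [← e1, ← e2] at h1 h2
  have hinj' : Function.Injective Pᴴ.mulVecLin := by
    rw [injective_iff_map_eq_zero]
    exact hinj
  have hs : s ≤ n := by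
    have := LinearMap.finrank_le_finrank_of_injective hinj'
    simpa using this
  rcases Nat.lt_or_ge s n with hlt | hge
  · exact absurd (HasDecomposition.mono ⟨P, Q, h0, h1, h2⟩ (by omega)) hn
  · obtain rfl : s = n := le_antisymm hs hge
    refine ⟨P, Q, h0, h1, h2, ?_⟩
    have h3 : IsUnit Pᴴ := Matrix.mulVec_injective_iff_isUnit.mp hinj'
    have h4 := (Matrix.isUnit_iff_isUnit_det _).mp h3
    rw [Matrix.det_conjTranspose] at h4
    intro h5
    simp [h5] at h4

/-! ### Equality of the cone and the spectrahedron. -/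

theorem posDef_conjTranspose_mul_self_of_det_ne_zero {n : ℕ} {A : Matrix (Fin n) (Fin n) ℂ}
    (hA : A.det ≠ 0) : (Aᴴ * A).PosDef :=
  .conjTranspose_mul_self A (Matrix.mulVec_injective_of_isUnit
    ((Matrix.isUnit_iff_isUnit_det A).mpr hA.isUnit))

/-- Otherwise the pencil is positive definite at some boundary point of D, which is then interior to
S₁ = D. -/
theorem hasDecomposition_of_circularCone_eq {n r : ℕ} {N : Fin 3 → Matrix (Fin n) (Fin n) ℂ}
    (hN : ∀ i, (N i).IsHermitian) (hr : HasDecomposition N r)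
    (h : circularCone = spectrahedron N) : HasDecomposition N (n - 1) := by
  by_contra hn
  obtain ⟨P, Q, h0, h1, h2, hP⟩ := hr.exists_outer hn
  obtain ⟨p, hp0, -, hp⟩ := exists_polynomial_det P Q hP
  obtain ⟨w, hw, hw'⟩ := infinite_unit_circle.exists_notMem_finset p.roots.toFinset
  have hdet : (P + w • Q).det ≠ 0 := by
    rw [← hp]
    intro h3
    exact hw' (by simp [hp0, h3])
  have hpd : (∑ i, ![1, w.re, -w.im] i • N i).PosDef := by
    rw [sum_smul_eq_of_decomposition h0 h1 h2 ![1, w.re, -w.im] 1 w hw (by simp) (by simp)]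
    simpa using posDef_conjTranspose_mul_self_of_det_ne_zero hdet
  have hint := mem_interior_spectrahedron hN hpd
  rw [← h, mem_interior_iff_mem_nhds] at hint
  -- Lowering the first coordinate of a boundary point leaves D at once.
  have hc : Filter.Tendsto (fun δ : ℝ => ![1 - δ, w.re, -w.im]) (nhdsWithin 0 (Set.Ioi 0))
      (nhds ![1, w.re, -w.im]) := by
    have : Continuous fun δ : ℝ => ![1 - δ, w.re, -w.im] := by fun_prop
    have := this.tendsto 0
    rw [sub_zero] at this
    exact this.mono_left nhdsWithin_le_nhds
  obtain ⟨δ, ⟨hδ1, hδ2⟩, hδ3⟩ := ((hc.eventually hint).and self_mem_nhdsWithin).exists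
  have := Complex.normSq_eq_norm_sq w
  have hw1 : ‖w‖ = 1 := hw
  rw [hw1, Complex.normSq_apply] at this
  simp at hδ1 hδ2 hδ3
  nlinarith

/-- The segment from (1, 0, 0) to a point of S₁ outside D meets the boundary of D at some t < 1,
where the pencil is (1 - t)N₀ plus a positive semidefinite matrix, hence positive definite. -/
theorem spectrahedron_subset_circularCone {n : ℕ} {N : Fin 3 → Matrix (Fin n) (Fin n) ℂ}
    (h0 : (N 0).PosDef)
    (hb : ∀ a : Fin 3 → ℝ, 0 ≤ a 0 → a 1 ^ 2 + a 2 ^ 2 = a 0 ^ 2 → ¬ (∑ i, a i • N i).PosDef) :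
    spectrahedron N ⊆ circularCone := by
  intro a ha
  by_contra hna
  rw [mem_circularCone_iff, not_le] at hna
  let f : ℝ → ℝ := fun t => (1 - t) + t * a 0 - √((t * a 1) ^ 2 + (t * a 2) ^ 2)
  have hf : Continuous f := by fun_prop
  have hf0 : f 0 = 1 := by simp [f]
  have hf1 : f 1 < 0 := by simpa [f] using hna
  obtain ⟨t, ht, hft⟩ := intermediate_value_Icc' zero_le_one hf.continuousOn
    (show (0 : ℝ) ∈ Set.Icc (f 1) (f 0) from ⟨hf1.le, by rw [hf0]; exact zero_le_one⟩)
  have ht1 : t < 1 := by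
    refine lt_of_le_of_ne ht.2 ?_
    rintro rfl
    exact hf1.ne hft
  have hft' : (1 - t) + t * a 0 = √((t * a 1) ^ 2 + (t * a 2) ^ 2) := sub_eq_zero.mp hft
  refine hb ![(1 - t) + t * a 0, t * a 1, t * a 2] ?_ ?_ ?_
  · simp only [Matrix.cons_val]
    rw [hft']
    exact Real.sqrt_nonneg _
  · simp only [Matrix.cons_val]
    rw [hft', Real.sq_sqrt (by positivity)]
  · have e : ∑ i, ![(1 - t) + t * a 0, t * a 1, t * a 2] i • N i =
        (1 - t) • N 0 + t • ∑ i, a i • N i := by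
      simp only [Fin.sum_univ_three, Matrix.cons_val]
      module
    rw [e]
    exact (h0.smul (sub_pos.mpr ht1)).add_posSemidef (Matrix.PosSemidef.smul ha ht.1)

theorem HasDecomposition.posDef {n r : ℕ} {N : Fin 3 → Matrix (Fin n) (Fin n) ℂ}
    (h : HasDecomposition N r) (hker : ∀ v : Fin n → ℂ, (∀ i, N i *ᵥ v = 0) → v = 0) :
    (N 0).PosDef := by
  have hpsd := h.posSemidef
  obtain ⟨P, Q, h0, h1, h2⟩ := h
  refine .of_dotProduct_mulVec_pos hpsd.isHermitian fun v hv => ?_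
  refine lt_of_le_of_ne (hpsd.dotProduct_mulVec_nonneg v) fun h => hv (hker v ?_)
  -- Since v*N₀v = |Pv|² + |Qv|², a null vector is killed by P and Q, hence by every Nᵢ.
  have e : star (P *ᵥ v) ⬝ᵥ (P *ᵥ v) + star (Q *ᵥ v) ⬝ᵥ (Q *ᵥ v) = 0 := by
    rw [h, h0, Matrix.add_mulVec, dotProduct_add, ← Matrix.mulVec_mulVec, ← Matrix.mulVec_mulVec,
      Matrix.star_mulVec, Matrix.star_mulVec, ← Matrix.dotProduct_mulVec,
      ← Matrix.dotProduct_mulVec]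
  obtain ⟨eP, eQ⟩ := (add_eq_zero_iff_of_nonneg (dotProduct_star_self_nonneg _)
    (dotProduct_star_self_nonneg _)).mp e
  rw [dotProduct_star_self_eq_zero] at eP eQ
  intro i
  fin_cases i
  · simp [h0, Matrix.add_mulVec, ← Matrix.mulVec_mulVec, eP, eQ]
  · simp [h1, Matrix.add_mulVec, ← Matrix.mulVec_mulVec, eP, eQ]
  · simp [h2, Matrix.smul_mulVec, Matrix.sub_mulVec, ← Matrix.mulVec_mulVec, eP, eQ]

theorem HasDecomposition.circularCone_eq {n r : ℕ} {N : Fin 3 → Matrix (Fin n) (Fin n) ℂ}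
    (h : HasDecomposition N r) (hr : r < n)
    (hker : ∀ v : Fin n → ℂ, (∀ i, N i *ᵥ v = 0) → v = 0) :
    circularCone = spectrahedron N := by
  refine h.circularCone_subset.antisymm (spectrahedron_subset_circularCone (h.posDef hker) ?_)
  obtain ⟨P, Q, h0, h1, h2⟩ := h
  intro a ha0 ha hpd
  obtain ⟨w, hw, hx, hy⟩ := exists_polar (a 1) (a 2)
  rw [sum_smul_eq_of_decomposition h0 h1 h2 a _ w hw hx hy, ha, Real.sqrt_sq ha0] at hpd
  obtain ⟨v, hv0, hv⟩ := (Submodule.ne_bot_iff _).mp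
    (LinearMap.ker_ne_bot_of_finrank_lt (f := (P + w • Q).mulVecLin) (by simpa using hr))
  rw [LinearMap.mem_ker, Matrix.mulVecLin_apply] at hv0
  have := hpd.dotProduct_mulVec_pos hv
  simp [Matrix.smul_mulVec, ← Matrix.mulVec_mulVec, hv0] at this

/-! ### Counting common boundary rays. -/

theorem ray_smul {d : ℕ} (x : Fin d → ℝ) {c : ℝ} (hc : 0 < c) :
    {y | ∃ t : ℝ, 0 ≤ t ∧ y = t • c • x} = {y | ∃ t : ℝ, 0 ≤ t ∧ y = t • x} := by
  ext y
  constructor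
  · rintro ⟨t, ht, rfl⟩
    exact ⟨t * c, by positivity, by rw [smul_smul]⟩
  · rintro ⟨t, ht, rfl⟩
    exact ⟨t / c, by positivity, by rw [smul_smul, div_mul_cancel₀ _ hc.ne']⟩

/-- The set of boundary rays of the spectrahedron that lie in the circular cone. -/
def coneBoundaryRays {n : ℕ} (N : Fin 3 → Matrix (Fin n) (Fin n) ℂ) : Set (Set (Fin 3 → ℝ)) :=
  {R | IsRay R ∧ R ⊆ circularCone ∧ R ⊆ frontier (spectrahedron N)}

theorem encard_coneBoundaryRays_le {n : ℕ} {N : Fin 3 → Matrix (Fin n) (Fin n) ℂ}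
    (hN : ∀ i, (N i).IsHermitian) (hpos : (N 0).PosDef) {P Q : Matrix (Fin n) (Fin n) ℂ}
    (h0 : N 0 = Pᴴ * P + Qᴴ * Q) (h1 : N 1 = Pᴴ * Q + Qᴴ * P)
    (h2 : N 2 = Complex.I • (Qᴴ * P - Pᴴ * Q)) (hP : P.det ≠ 0) :
    (coneBoundaryRays N).encard ≤ n := by
  obtain ⟨p, hp0, hdeg, hp⟩ := exists_polynomial_det P Q hP
  let g : ℂ → Set (Fin 3 → ℝ) := fun w => {y | ∃ t : ℝ, 0 ≤ t ∧ y = t • ![1, w.re, -w.im]}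
  have hsub : coneBoundaryRays N ⊆ g '' (p.roots.toFinset : Set ℂ) := by
    rintro R ⟨⟨x, hx0, rfl⟩, hRc, hRf⟩
    have hxR : x ∈ {y | ∃ t : ℝ, 0 ≤ t ∧ y = t • x} := ⟨1, zero_le_one, by simp⟩
    have hxc := hRc hxR
    have hxf := (hRf hxR).2
    have hxle := mem_circularCone_iff.mp hxc
    have hx00 : 0 < x 0 := by
      refine lt_of_le_of_ne hxc.1 fun h => hx0 ?_
      have h3 := hxc.2
      rw [← h] at h3
      ext i
      fin_cases i
      · exact h.symm
      · simp; nlinarith [sq_nonneg (x 1), sq_nonneg (x 2)]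
      · simp; nlinarith [sq_nonneg (x 1), sq_nonneg (x 2)]
    obtain ⟨w, hw, hx1, hx2⟩ := exists_polar (x 1) (x 2)
    have hsum := sum_smul_eq_of_decomposition h0 h1 h2 x _ w hw hx1 hx2
    -- Strictly inside D the pencil is positive definite because N₀ is, so such points are not in
    -- the frontier of S₁.
    have hρ : √(x 1 ^ 2 + x 2 ^ 2) = x 0 := by
      refine le_antisymm hxle (not_lt.mp fun hlt => hxf (mem_interior_spectrahedron hN ?_))
      rw [hsum]
      exact (hpos.smul (sub_pos.mpr hlt)).add_posSemidef
        ((Matrix.posSemidef_conjTranspose_mul_self _).smul (Real.sqrt_nonneg _))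
    rw [hρ] at hx1 hx2 hsum
    refine ⟨w, ?_, ?_⟩
    · have hdet : (P + w • Q).det = 0 := by
        by_contra hne
        refine hxf (mem_interior_spectrahedron hN ?_)
        rw [hsum, sub_self, zero_smul, zero_add]
        exact (posDef_conjTranspose_mul_self_of_det_ne_zero hne).smul hx00
      simp [hp0, hp, hdet]
    · have hxe : x = x 0 • ![1, w.re, -w.im] := by
        ext i
        fin_cases i
        · simp
        · simpa using hx1
        · simpa using hx2
      simp only [g]
      rw [hxe, ray_smul _ hx00]
  calc (coneBoundaryRays N).encard ≤ (g '' (p.roots.toFinset : Set ℂ)).encard :=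
        Set.encard_le_encard hsub
    _ ≤ (p.roots.toFinset : Set ℂ).encard := Set.encard_image_le _ _
    _ = (p.roots.toFinset.card : ℕ∞) := Set.encard_coe_eq_coe_finsetCard _
    _ ≤ n := by
        exact_mod_cast (Multiset.toFinset_card_le _).trans (p.card_roots'.trans hdeg)

/-! ### Removing the common kernel; the main theorem. -/

/-- Splitting off the common kernel of a tuple of Hermitian matrices. -/
theorem exists_compression {n : ℕ} {N : Fin 3 → Matrix (Fin n) (Fin n) ℂ}
    (hN : ∀ i, (N i).IsHermitian) :
    ∃ (s : ℕ) (E : Matrix (Fin n) (Fin s) ℂ), s ≤ n ∧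
      (∀ i, E * (Eᴴ * N i * E) * Eᴴ = N i) ∧
      ∀ v : Fin s → ℂ, (∀ i, (Eᴴ * N i * E) *ᵥ v = 0) → v = 0 := by
  -- The column space of the matrices Nᵢ placed side by side is the orthogonal complement of their
  -- common kernel.
  obtain ⟨s, E, hE, hEA, hE0⟩ := exists_isometry_columnSpace
    (Matrix.of fun i (p : Fin 3 × Fin n) => N p.1 i p.2)
  have hl : ∀ i, E * Eᴴ * N i = N i := by
    intro k
    ext i j
    exact congrFun (congrFun hEA i) (k, j)
  have hr : ∀ i, N i * (E * Eᴴ) = N i := by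
    intro i
    have := congrArg Matrix.conjTranspose (hl i)
    simpa [Matrix.conjTranspose_mul, (hN i).eq] using this
  have hinj : Function.Injective E.mulVecLin := by
    rw [injective_iff_map_eq_zero]
    intro u hu
    have := congrArg (Eᴴ.mulVec) hu
    simpa [Matrix.mulVec_mulVec, hE] using this
  refine ⟨s, E, by simpa using LinearMap.finrank_le_finrank_of_injective hinj, ?_, ?_⟩
  · intro i
    calc E * (Eᴴ * N i * E) * Eᴴ = (E * Eᴴ * N i) * (E * Eᴴ) := by simp only [Matrix.mul_assoc]
      _ = N i := by rw [hl, hr]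
  · intro v hv
    have h1 : ∀ i, N i *ᵥ (E *ᵥ v) = 0 := by
      intro i
      have := congrArg E.mulVec (hv i)
      rw [Matrix.mulVec_mulVec, Matrix.mulVec_zero, ← Matrix.mul_assoc, ← Matrix.mul_assoc, hl,
        ← Matrix.mulVec_mulVec] at this
      exact this
    have h2 : Eᴴ *ᵥ (E *ᵥ v) = 0 := by
      apply hE0
      ext ⟨i, j⟩
      have := congrFun (h1 i) j
      rw [← (hN i).eq] at this
      exact this
    rwa [Matrix.mulVec_mulVec, hE, Matrix.one_mulVec] at h2

theorem spectrahedron_compression {d n s : ℕ} {N : Fin d → Matrix (Fin n) (Fin n) ℂ}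
    {E : Matrix (Fin n) (Fin s) ℂ} (hE : ∀ i, E * (Eᴴ * N i * E) * Eᴴ = N i) :
    spectrahedron (fun i => Eᴴ * N i * E) = spectrahedron N := by
  ext a
  have h1 : ∑ i, a i • (Eᴴ * N i * E) = Eᴴ * (∑ i, a i • N i) * E := by
    simp [Matrix.mul_sum, Matrix.sum_mul]
  have h2 : ∑ i, a i • N i = E * (∑ i, a i • (Eᴴ * N i * E)) * Eᴴ := by
    simp only [Matrix.mul_sum, Matrix.sum_mul, Matrix.mul_smul, Matrix.smul_mul, hE]
  constructor
  · intro h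
    change (∑ i, a i • N i).PosSemidef
    rw [h2]
    exact Matrix.PosSemidef.mul_mul_conjTranspose_same h E
  · intro h
    change (∑ i, a i • (Eᴴ * N i * E)).PosSemidef
    rw [h1]
    exact Matrix.PosSemidef.conjTranspose_mul_mul_same h E

theorem HasDecomposition.of_compression {n s r : ℕ} {N : Fin 3 → Matrix (Fin n) (Fin n) ℂ}
    {E : Matrix (Fin n) (Fin s) ℂ} (hE : ∀ i, E * (Eᴴ * N i * E) * Eᴴ = N i)
    (h : HasDecomposition (fun i => Eᴴ * N i * E) r) : HasDecomposition N r := by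
  obtain ⟨P, Q, h0, h1, h2⟩ := h
  beta_reduce at h0 h1 h2
  have key : ∀ A B : Matrix (Fin r) (Fin s) ℂ, (A * Eᴴ)ᴴ * (B * Eᴴ) = E * (Aᴴ * B) * Eᴴ := by
    intro A B
    simp [Matrix.conjTranspose_mul, Matrix.mul_assoc]
  refine ⟨P * Eᴴ, Q * Eᴴ, ?_, ?_, ?_⟩
  · rw [← hE 0, h0]; simp only [key, Matrix.mul_add, Matrix.add_mul]
  · rw [← hE 1, h1]; simp only [key, Matrix.mul_add, Matrix.add_mul]
  · rw [← hE 2, h2]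
    simp only [key, Matrix.mul_sub, Matrix.sub_mul, Matrix.mul_smul, Matrix.smul_mul]

theorem circularCone_eq_and_hasDecomposition_of_le_encard {n : ℕ}
    {N : Fin 3 → Matrix (Fin n) (Fin n) ℂ} (hN : ∀ i, (N i).IsHermitian)
    (h : circularCone ⊆ spectrahedron N)
    (hrays : ((n + 1 : ℕ) : ℕ∞) ≤ (coneBoundaryRays N).encard) :
    circularCone = spectrahedron N ∧ HasDecomposition N (n - 1) := by
  obtain ⟨s, E, hsn, hE, hker⟩ := exists_compression hN
  set N' : Fin 3 → Matrix (Fin s) (Fin s) ℂ := fun i => Eᴴ * N i * E with hN'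
  have hS : spectrahedron N' = spectrahedron N := spectrahedron_compression hE
  have hNh : ∀ i, (N' i).IsHermitian := fun i =>
    Matrix.isHermitian_conjTranspose_mul_mul E (hN i)
  have hR : coneBoundaryRays N' = coneBoundaryRays N := by
    unfold coneBoundaryRays
    rw [hS]
  -- For s = 0 the spectrahedron is the whole space and has empty frontier. Positivity is needed so
  -- that s - 1 < s.
  have hs : 0 < s := by
    rcases Nat.eq_zero_or_pos s with rfl | hs
    · have hu : spectrahedron N = Set.univ := by
        rw [← hS, Set.eq_univ_iff_forall]
        intro a
        change (∑ i, a i • N' i).PosSemidef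
        rw [Subsingleton.elim (∑ i, a i • N' i) 0]
        exact Matrix.PosSemidef.zero
      have he : coneBoundaryRays N = ∅ := by
        rw [Set.eq_empty_iff_forall_notMem]
        rintro R ⟨⟨x, -, rfl⟩, -, hf⟩
        rw [hu, frontier_univ] at hf
        exact hf ⟨1, zero_le_one, rfl⟩
      rw [he, Set.encard_empty] at hrays
      simp at hrays
    · exact hs
  obtain ⟨r, hr⟩ := exists_hasDecomposition hNh (h.trans hS.symm.subset)
  -- Compression keeps the spectrahedron and hence its rays, so n + 1 > s of them exceed the bound s
  -- for invertible P.
  have hd : HasDecomposition N' (s - 1) := by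
    by_contra hn
    obtain ⟨P, Q, h0, h1, h2, hP⟩ := hr.exists_outer hn
    have hle := encard_coneBoundaryRays_le hNh (hr.posDef hker) h0 h1 h2 hP
    rw [hR] at hle
    have : n + 1 ≤ s := by exact_mod_cast hrays.trans hle
    omega
  refine ⟨?_, (HasDecomposition.of_compression hE hd).mono (by omega)⟩
  rw [← hS]
  exact hd.circularCone_eq (by omega) hker

theorem mainTheorem1 (n : ℕ) (hn : 1 ≤ n) (N : Fin 3 → Matrix (Fin n) (Fin n) ℂ)
    (hN : ∀ i, (N i).IsHermitian) :
    (circularCone ⊆ spectrahedron N ↔ ∃ r : ℕ, HasDecomposition N r) ∧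
    (circularCone = spectrahedron N → HasDecomposition N (n - 1)) ∧
    ((∀ v : Fin n → ℂ, (∀ i, N i *ᵥ v = 0) → v = 0) →
      HasDecomposition N (n - 1) → circularCone = spectrahedron N) ∧
    (circularCone ⊆ spectrahedron N →
      ((n + 1 : ℕ) : ℕ∞) ≤
        {R : Set (Fin 3 → ℝ) |
          IsRay R ∧ R ⊆ circularCone ∧ R ⊆ frontier (spectrahedron N)}.encard →
      circularCone = spectrahedron N ∧ HasDecomposition N (n - 1)) := by
  refine ⟨⟨exists_hasDecomposition hN, fun ⟨r, h⟩ => h.circularCone_subset⟩, fun h => ?_,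
    fun hker h => h.circularCone_eq (by omega) hker,
    circularCone_eq_and_hasDecomposition_of_le_encard hN⟩
  obtain ⟨r, hr⟩ := exists_hasDecomposition hN h.subset
  exact hasDecomposition_of_circularCone_eq hN hr h
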